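/- Let $X$ be a nontrivial complex Banach space with closed unit ball $B_X$. Let $C_b(B_X)$ be the algebra of bounded continuous functions $f:B_X\to\mathbb{C}$ with the supremum norm, let $A_b(B_X)$ be the subalgebra of those $f\in C_b(B_X)$ that are holomorphic on the interior of $B_X$, and let $A_u(B_X)$ be the subalgebra of those $f\in A_b(B_X)$ that are uniformly continuous on $B_X$. Then $C_b(B_X)$, $A_b(B_X)$ and $A_u(B_X)$ are function algebras on $B_X$ (that is, closed subalgebras of $C_b(B_X)$ that contain the constants and separate the points of $B_X$), and each of them has the symmetric strong diameter two property (SSD2P). Here a complex Banach space $E$ with closed unit ball $B_E$ has the SSD2P if for all $n\in\mathbb{N}$, all slices $S_i=\{x\in B_E:\operatorname{Re} x_i^*(x)>1-\alpha_i\}$ with $x_i^*\in E^*$, $\|x_i^*\|=1$, $\alpha_i>0$ $(i=1,\dots,n)$, and all $\varepsilon>0$, there exist $x_i\in S_i$ $(i=1,\dots,n)$ and $y\in B_E$ such that $x_i+y\in S_i$ and $x_i-y\in S_i$ for every $i$, and $\|y\|>1-\varepsilon$. -/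

import Mathlib

open scoped BoundedContinuousFunction

/-- The slice `S(φ, α) = {x ∈ B_E : Re φ x > 1 - α}` of the closed unit ball of `E`. -/
def unitBallSlice {E : Type*} [NormedAddCommGroup E] [NormedSpace ℂ E]
    (φ : StrongDual ℂ E) (α : ℝ) : Set E :=
  {x | ‖x‖ ≤ 1 ∧ 1 - α < (φ x).re}

/-- The symmetric strong diameter two property: given finitely many slices `S(φ i, α i)`
(`‖φ i‖ = 1`, `α i > 0`) of the closed unit ball and `ε > 0`, there are `x i` in the `i`-th slice
and a single `y` in the unit ball with `x i ± y` in the `i`-th slice and `‖y‖ > 1 - ε`. -/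
def HasSSD2P (E : Type*) [NormedAddCommGroup E] [NormedSpace ℂ E] : Prop :=
  ∀ (n : ℕ) (φ : Fin n → StrongDual ℂ E) (α : Fin n → ℝ),
    (∀ i, ‖φ i‖ = 1) → (∀ i, 0 < α i) → ∀ ε : ℝ, 0 < ε →
      ∃ (x : Fin n → E) (y : E), ‖y‖ ≤ 1 ∧ 1 - ε < ‖y‖ ∧
        ∀ i, x i ∈ unitBallSlice (φ i) (α i) ∧
          x i + y ∈ unitBallSlice (φ i) (α i) ∧
          x i - y ∈ unitBallSlice (φ i) (α i)

/-- A function algebra on `Ω`: a closed subalgebra of `C_b(Ω)` that separates the points of `Ω`.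
(A `Subalgebra ℂ` contains the constant functions.) -/
structure IsFunctionAlgebra {Ω : Type*} [TopologicalSpace Ω] (A : Subalgebra ℂ (Ω →ᵇ ℂ)) :
    Prop where
  isClosed : IsClosed (A : Set (Ω →ᵇ ℂ))
  separatesPoints : ∀ s t : Ω, s ≠ t → ∃ f ∈ A, f s ≠ f t

/-- The closed unit ball `B_X`, with the topology and the metric of the norm. -/
abbrev UnitBall (X : Type*) [NormedAddCommGroup X] : Type _ :=
  Metric.closedBall (0 : X) 1

/-- `f : B_X → ℂ` is holomorphic (complex Fréchet differentiable) on the interior of `B_X`. -/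
def HolomorphicInside {X : Type*} [NormedAddCommGroup X] [NormedSpace ℂ X]
    (f : UnitBall X → ℂ) : Prop :=
  ∃ F : X → ℂ, DifferentiableOn ℂ F (Metric.ball 0 1) ∧
    ∀ x : UnitBall X, (x : X) ∈ Metric.ball (0 : X) 1 → F x = f x

/-- `C_b(B_X)`: all bounded continuous functions `B_X → ℂ`, with the supremum norm, as the
largest subalgebra of itself. -/
noncomputable def ballCb (X : Type*) [NormedAddCommGroup X] : Subalgebra ℂ (UnitBall X →ᵇ ℂ) := ⊤

/-- `A_b(B_X)`: the functions in `C_b(B_X)` that are holomorphic on the interior of `B_X`. -/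
noncomputable def ballAb (X : Type*) [NormedAddCommGroup X] [NormedSpace ℂ X] :
    Subalgebra ℂ (UnitBall X →ᵇ ℂ) where
  carrier := {f | HolomorphicInside f}
  mul_mem' := by
    rintro f g ⟨F, hF, hf⟩ ⟨G, hG, hg⟩
    exact ⟨F * G, hF.mul hG, fun x hx => by simp [hf x hx, hg x hx]⟩
  add_mem' := by
    rintro f g ⟨F, hF, hf⟩ ⟨G, hG, hg⟩
    exact ⟨F + G, hF.add hG, fun x hx => by simp [hf x hx, hg x hx]⟩
  algebraMap_mem' c :=
    ⟨fun _ => c, differentiableOn_const c, fun _ _ => rfl⟩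

/-- `A_u(B_X)`: the functions in `A_b(B_X)` that are uniformly continuous on `B_X`. -/
noncomputable def ballAu (X : Type*) [NormedAddCommGroup X] [NormedSpace ℂ X] :
    Subalgebra ℂ (UnitBall X →ᵇ ℂ) where
  carrier := {f | f ∈ ballAb X ∧ UniformContinuous f}
  mul_mem' := by
    rintro f g ⟨hf, uf⟩ ⟨hg, ug⟩
    refine ⟨mul_mem hf hg, ?_⟩
    rw [Metric.uniformContinuous_iff] at *
    intro ε hε
    have hM : 0 < ‖f‖ + ‖g‖ + 1 := by positivity
    obtain ⟨d, hd, h1⟩ := uf (ε / (‖f‖ + ‖g‖ + 1)) (by positivity)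
    obtain ⟨e, he, h2⟩ := ug (ε / (‖f‖ + ‖g‖ + 1)) (by positivity)
    refine ⟨min d e, lt_min hd he, fun a b hab => ?_⟩
    have k1 := h1 (hab.trans_le (min_le_left _ _))
    have k2 := h2 (hab.trans_le (min_le_right _ _))
    rw [dist_eq_norm] at k1 k2 ⊢
    have hEq : (f * g) a - (f * g) b = f a * (g a - g b) + (f a - f b) * g b := by
      simp only [BoundedContinuousFunction.mul_apply]; ring
    rw [hEq]
    calc ‖f a * (g a - g b) + (f a - f b) * g b‖
        ≤ ‖f a‖ * ‖g a - g b‖ + ‖f a - f b‖ * ‖g b‖ := by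
          refine (norm_add_le _ _).trans ?_
          rw [norm_mul, norm_mul]
      _ ≤ ‖f‖ * (ε / (‖f‖ + ‖g‖ + 1)) + (ε / (‖f‖ + ‖g‖ + 1)) * ‖g‖ := by
          gcongr
          · exact f.norm_coe_le_norm a
          · exact g.norm_coe_le_norm b
      _ = ε * ((‖f‖ + ‖g‖) / (‖f‖ + ‖g‖ + 1)) := by ring
      _ < ε * 1 := by
          gcongr
          rw [div_lt_one hM]; linarith
      _ = ε := mul_one ε
  add_mem' := by
    rintro f g ⟨hf, uf⟩ ⟨hg, ug⟩
    exact ⟨add_mem hf hg, uf.add ug⟩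
  algebraMap_mem' c := ⟨(ballAb X).algebraMap_mem c, uniformContinuous_const (b := c)⟩

/-! Suppose an algebra contains functions `h k` that nearly peak, satisfy `|h k| + |1 - h k| ≤ 1 +
η`, and have `∑ k, |h k| ≤ 3`. For `f` in the unit ball, every unimodular combination of the `f * h
k` then has norm at most 3, so `∑ k, |φ (f * h k)| ≤ 3` for a norm-one functional `φ`. With many
functions, some `h k` is nearly invisible to all the given functionals, both alone and multiplied by
the chosen slice elements `f i`. For that `k`, the elements `x i = f i * (1 - h k)` and `y = h k`,
both divided by `1 + η`, witness the SSD2P (`HasPeakSystems.hasSSD2P`).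

Such families already exist in `A_u`: compose one disc function peaking near 1
(`exists_disc_peak_function`) with rotations of a norm-attaining functional
(`hasPeakSystems_ballAu`). The larger algebras inherit them. Functionals separate points; closedness
of `A_b` comes from Cauchy estimates. -/

open Filter Topology Metric

/-! ### Peak functions on the disc -/

section PeakFunctions

/-- On the sector `|arg u| ≤ θ` the map `u ↦ u / (1 + u)` takes values in a Stolz-type region. -/
theorem norm_add_norm_one_sub_le_of_re {u : ℂ} {κ : ℝ} (hκ : 0 < κ) (hκ1 : κ ≤ 1)
    (hu : κ * ‖u‖ ≤ u.re) :
    ‖u / (1 + u)‖ + ‖1 - u / (1 + u)‖ ≤ κ⁻¹ := by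
  have hre : κ * (1 + ‖u‖) ≤ ‖1 + u‖ := by
    refine le_trans ?_ (Complex.re_le_norm _)
    simp only [Complex.add_re, Complex.one_re]
    linarith
  have hpos : 0 < ‖1 + u‖ := lt_of_lt_of_le (by positivity) hre
  have hne : 1 + u ≠ 0 := norm_pos_iff.mp hpos
  have h1 : 1 - u / (1 + u) = 1 / (1 + u) := by field_simp; ring
  rw [h1, norm_div, norm_div, norm_one, ← add_div, div_le_iff₀ hpos, ← div_eq_inv_mul,
    le_div_iff₀ hκ]
  linarith

theorem norm_div_one_add_le {u : ℂ} (hu : 0 ≤ u.re) : ‖u / (1 + u)‖ ≤ ‖u‖ := by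
  have h : 1 ≤ ‖1 + u‖ := by
    refine le_trans ?_ (Complex.re_le_norm _)
    simpa using hu
  rw [norm_div]
  exact div_le_self (norm_nonneg _) h

/-- A power with a small exponent maps the right half-plane into a thin sector. -/
theorem Complex.mul_norm_cpow_le_re {v : ℂ} (hv : 0 < v.re) (s : ℝ) :
    (1 - 2 * s ^ 2) * ‖v ^ (s : ℂ)‖ ≤ (v ^ (s : ℂ)).re := by
  have harg : |v.arg| < Real.pi / 2 := Complex.abs_arg_lt_pi_div_two_iff.mpr (Or.inl hv)
  have harg2 : |v.arg| ≤ 2 := by linarith [Real.pi_le_four]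
  -- Since `|arg v| ≤ 2`, the bound `cos x ≥ 1 - x²/2` at `x = s * arg v` gives this constant.
  have hcos : 1 - 2 * s ^ 2 ≤ Real.cos (v.arg * s) := by
    refine le_trans ?_ Real.one_sub_sq_div_two_le_cos
    have h1 : v.arg ^ 2 ≤ 2 ^ 2 := sq_le_sq' (by linarith [abs_le.mp harg2]) (abs_le.mp harg2).2
    have h2 : v.arg ^ 2 * s ^ 2 ≤ 2 ^ 2 * s ^ 2 := by gcongr
    linarith [mul_pow v.arg s 2]
  rw [Complex.norm_cpow_real, Complex.cpow_ofReal_re, mul_comm]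
  gcongr

/-- For each `r > 0` there is a function holomorphic on a neighbourhood of the closed unit disc
which nearly peaks at `1`, is small off the `r`-neighbourhood of `1`, and has values in a
Stolz-type region. -/
theorem exists_disc_peak_function {ε r : ℝ} (hε : 0 < ε) (hr : 0 < r) :
    ∃ g : ℂ → ℂ, DifferentiableOn ℂ g (closedBall 0 1) ∧
      (∀ w : ℂ, ‖w‖ ≤ 1 → ‖g w‖ + ‖1 - g w‖ ≤ 1 + ε) ∧
      (∀ w : ℂ, ‖w‖ ≤ 1 → r ≤ ‖1 - w‖ → ‖g w‖ ≤ ε) ∧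
      1 - ε < ‖g 1‖ := by
  set s : ℝ := ε / (4 * (1 + ε)) with hs
  have hs0 : 0 < s := by positivity
  have hs1 : s * (4 * (1 + ε)) = ε := by rw [hs]; field_simp
  have hs2 : s ≤ 1 / 4 := by
    rw [hs, div_le_iff₀ (by positivity)]; linarith
  set κ : ℝ := 1 - 2 * s ^ 2 with hκ
  have hκ0 : 0 < κ := by nlinarith
  have hκ1 : κ ≤ 1 := by nlinarith
  have hκε : κ⁻¹ ≤ 1 + ε := by
    rw [inv_le_iff_one_le_mul₀ hκ0]
    have : 2 * s ^ 2 ≤ s := by nlinarith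
    have h2 : (1 - s) * (1 + ε) ≤ κ * (1 + ε) := by gcongr; linarith
    nlinarith
  -- Chosen so that `q ^ s = ε`. Below, `|v w| ≤ q` when `|1 - w| ≥ r`, while `v 1 = 1/q`; after the
  -- power `s` these become `ε` and `1/ε`, so the value at 1 is `1/(1 + ε)`.
  set q : ℝ := ε ^ s⁻¹ with hq
  have hq0 : 0 < q := Real.rpow_pos_of_pos hε _
  have hqs : q ^ s = ε := by rw [hq, Real.rpow_inv_rpow hε.le hs0.ne']
  have hd0 : 0 < r * q * q := by positivity
  set v : ℂ → ℂ := fun w => ((r * q : ℝ) : ℂ) / (1 + ((r * q * q : ℝ) : ℂ) - w) with hv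
  have hden : ∀ w : ℂ, ‖w‖ ≤ 1 → 0 < (1 + ((r * q * q : ℝ) : ℂ) - w).re := by
    intro w hw
    have := (Complex.re_le_norm w).trans hw
    simp only [Complex.add_re, Complex.sub_re, Complex.one_re, Complex.ofReal_re]
    linarith
  have hden0 : ∀ w : ℂ, ‖w‖ ≤ 1 → 1 + ((r * q * q : ℝ) : ℂ) - w ≠ 0 := by
    intro w hw h
    have := hden w hw
    rw [h] at this
    simp at this
  have hvre : ∀ w : ℂ, ‖w‖ ≤ 1 → 0 < (v w).re := by
    intro w hw
    have h1 := hden w hw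
    have h2 : 0 < Complex.normSq (1 + ((r * q * q : ℝ) : ℂ) - w) :=
      Complex.normSq_pos.mpr (hden0 w hw)
    simp only [hv, div_eq_mul_inv, Complex.re_ofReal_mul, Complex.inv_re]
    positivity
  have hsec : ∀ w : ℂ, ‖w‖ ≤ 1 → κ * ‖v w ^ (s : ℂ)‖ ≤ (v w ^ (s : ℂ)).re := fun w hw =>
    Complex.mul_norm_cpow_le_re (hvre w hw) s
  have hupos : ∀ w : ℂ, ‖w‖ ≤ 1 → 0 ≤ (v w ^ (s : ℂ)).re := fun w hw =>
    le_trans (by positivity) (hsec w hw)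
  refine ⟨fun w => v w ^ (s : ℂ) / (1 + v w ^ (s : ℂ)), ?_, ?_, ?_, ?_⟩
  · intro w hw
    have hw1 : ‖w‖ ≤ 1 := by simpa using hw
    have hvd : DifferentiableAt ℂ v w := by
      refine DifferentiableAt.div (by fun_prop) (by fun_prop) (hden0 w hw1)
    have hud : DifferentiableAt ℂ (fun w => v w ^ (s : ℂ)) w :=
      hvd.cpow (by fun_prop) (Or.inl (hvre w hw1))
    refine (hud.div (hud.const_add 1) ?_).differentiableWithinAt
    intro h
    have h1 := congrArg Complex.re h
    have h2 := hupos w hw1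
    simp only [Complex.add_re, Complex.one_re, Complex.zero_re] at h1
    linarith
  · intro w hw
    exact (norm_add_norm_one_sub_le_of_re hκ0 hκ1 (hsec w hw)).trans hκε
  · intro w hw hrw
    refine (norm_div_one_add_le (hupos w hw)).trans ?_
    rw [Complex.norm_cpow_real, ← hqs]
    refine Real.rpow_le_rpow (norm_nonneg _) ?_ hs0.le
    -- As `Re w ≤ 1`, moving the pole from 1 to the right only increases its distance to `w`.
    have hrw' : r ≤ ‖1 + ((r * q * q : ℝ) : ℂ) - w‖ := by
      refine hrw.trans ?_
      rw [Complex.norm_def, Complex.norm_def]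
      refine Real.sqrt_le_sqrt ?_
      have := (Complex.re_le_norm w).trans hw
      simp only [Complex.normSq_apply, Complex.add_re, Complex.sub_re, Complex.one_re,
        Complex.ofReal_re, Complex.add_im, Complex.sub_im, Complex.one_im, Complex.ofReal_im]
      nlinarith
    simp only [hv]
    rw [norm_div, Complex.norm_real, Real.norm_of_nonneg (by positivity),
      div_le_iff₀ (hr.trans_le hrw')]
    nlinarith
  · have hv1 : v 1 = ((q⁻¹ : ℝ) : ℂ) := by
      simp only [hv]
      rw [add_sub_cancel_left, ← Complex.ofReal_div]
      congr 1
      field_simp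
    have hu1 : v 1 ^ (s : ℂ) = ((ε⁻¹ : ℝ) : ℂ) := by
      rw [hv1, ← Complex.ofReal_cpow (by positivity), Real.inv_rpow hq0.le, hqs]
    have : v 1 ^ (s : ℂ) / (1 + v 1 ^ (s : ℂ)) = (((1 + ε)⁻¹ : ℝ) : ℂ) := by
      rw [hu1, ← Complex.ofReal_one, ← Complex.ofReal_add, ← Complex.ofReal_div]
      congr 1
      field_simp
      ring
    simp only [this]
    rw [Complex.norm_real, Real.norm_of_nonneg (by positivity), ← one_div, lt_div_iff₀ (by positivity)]
    nlinarith

end PeakFunctions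

/-! ### Norm estimates for functionals -/

section Duality

variable {E : Type*} [NormedAddCommGroup E] [NormedSpace ℂ E]

/-- Unimodular coefficients rotate each `φ (v k)` onto the positive axis, turning the sum of moduli
into a single value of `φ`. -/
theorem sum_norm_apply_le_of_forall_norm_sum_le {ι : Type*} [Fintype ι] (φ : StrongDual ℂ E)
    (v : ι → E) (C : ℝ) (h : ∀ c : ι → ℂ, (∀ k, ‖c k‖ = 1) → ‖∑ k, c k • v k‖ ≤ C) :
    ∑ k, ‖φ (v k)‖ ≤ ‖φ‖ * C := by
  choose c hc hcv using fun k => RCLike.exists_norm_eq_mul_self (φ (v k))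
  have hsum : ((∑ k, ‖φ (v k)‖ : ℝ) : ℂ) = φ (∑ k, c k • v k) := by
    rw [map_sum, Complex.ofReal_sum]
    refine Finset.sum_congr rfl fun k _ => ?_
    rw [map_smul, smul_eq_mul]
    exact hcv k
  have hnn : 0 ≤ ∑ k, ‖φ (v k)‖ := Finset.sum_nonneg fun k _ => norm_nonneg _
  calc ∑ k, ‖φ (v k)‖ = ‖((∑ k, ‖φ (v k)‖ : ℝ) : ℂ)‖ := by
        rw [Complex.norm_real, Real.norm_of_nonneg hnn]
    _ ≤ ‖φ‖ * ‖∑ k, c k • v k‖ := by rw [hsum]; exact φ.le_opNorm _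
    _ ≤ ‖φ‖ * C := by gcongr; exact h c hc

theorem exists_norm_le_one_lt_re_apply (φ : StrongDual ℂ E) {r : ℝ} (hr : r < ‖φ‖) :
    ∃ x : E, ‖x‖ ≤ 1 ∧ r < (φ x).re := by
  obtain ⟨x, hx, hrx⟩ := φ.exists_lt_apply_of_lt_opNorm hr
  obtain ⟨c, hc, hcx⟩ := RCLike.exists_norm_eq_mul_self (φ x)
  refine ⟨c • x, by rw [norm_smul, hc, one_mul]; exact hx.le, ?_⟩
  rw [map_smul, smul_eq_mul, ← hcx]
  simpa using hrx

end Duality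

/-! ### From peak systems to the SSD2P -/

section SymmetricStrongDiameterTwo

variable {Ω : Type*} [TopologicalSpace Ω]

/-- `A` contains arbitrarily long finite families of almost peaking functions with values in
thin Stolz-type regions, whose moduli have uniformly bounded sums. -/
def HasPeakSystems (A : Subalgebra ℂ (Ω →ᵇ ℂ)) : Prop :=
  ∀ (N : ℕ) (ε : ℝ), 0 < ε → ∃ h : Fin N → (Ω →ᵇ ℂ), (∀ k, h k ∈ A) ∧
    (∀ k x, ‖h k x‖ + ‖1 - h k x‖ ≤ 1 + ε) ∧ (∀ x, ∑ k, ‖h k x‖ ≤ 3) ∧ ∀ k, 1 - ε < ‖h k‖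

theorem HasPeakSystems.mono {A B : Subalgebra ℂ (Ω →ᵇ ℂ)} (hAB : A ≤ B) (hA : HasPeakSystems A) :
    HasPeakSystems B := fun N ε hε =>
  let ⟨h, hm, hh⟩ := hA N ε hε
  ⟨h, fun k => hAB (hm k), hh⟩

theorem sum_norm_apply_mul_le {A : Subalgebra ℂ (Ω →ᵇ ℂ)} {ι : Type*} [Fintype ι]
    (φ : StrongDual ℂ A) (hφ : ‖φ‖ = 1) (f : A) (hf : ‖f‖ ≤ 1) (h : ι → A) {C : ℝ} (hC : 0 ≤ C)
    (hh : ∀ x, ∑ k, ‖(h k : Ω →ᵇ ℂ) x‖ ≤ C) : ∑ k, ‖φ (f * h k)‖ ≤ C := by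
  have := sum_norm_apply_le_of_forall_norm_sum_le φ (fun k => f * h k) C fun c hc => by
    change ‖((∑ k, c k • (f * h k) : A) : Ω →ᵇ ℂ)‖ ≤ C
    refine (BoundedContinuousFunction.norm_le hC).mpr fun x => ?_
    have hx : ((∑ k, c k • (f * h k) : A) : Ω →ᵇ ℂ) x
        = ∑ k, c k * ((f : Ω →ᵇ ℂ) x * (h k : Ω →ᵇ ℂ) x) := by
      rw [AddSubmonoidClass.coe_finsetSum, BoundedContinuousFunction.sum_apply]
      rfl
    rw [hx]
    refine (norm_sum_le _ _).trans (le_trans (Finset.sum_le_sum fun k _ => ?_) (hh x))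
    rw [norm_mul, norm_mul, hc, one_mul]
    have : ‖(f : Ω →ᵇ ℂ) x‖ ≤ 1 := ((f : Ω →ᵇ ℂ).norm_coe_le_norm x).trans hf
    exact mul_le_of_le_one_left (norm_nonneg _) this
  rwa [hφ, one_mul] at this

theorem HasPeakSystems.hasSSD2P {A : Subalgebra ℂ (Ω →ᵇ ℂ)} (hA : HasPeakSystems A) :
    HasSSD2P A := by
  intro n φ α hφ hα ε hε
  obtain ⟨η, hη, hηε, hηα⟩ : ∃ η : ℝ, 0 < η ∧ 2 * η ≤ ε ∧ ∀ i, 3 * η ≤ α i := by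
    have h0 : ∀ᶠ η : ℝ in 𝓝[>] 0, 0 < η := self_mem_nhdsWithin
    have hc : ∀ c a : ℝ, 0 < a → ∀ᶠ η : ℝ in 𝓝[>] 0, c * η ≤ a := fun c a ha => by
      have : Tendsto (fun η : ℝ => c * η) (𝓝[>] 0) (𝓝 0) := by
        have : Continuous fun η : ℝ => c * η := by fun_prop
        simpa using (this.tendsto 0).mono_left nhdsWithin_le_nhds
      exact this.eventually_le_const ha
    obtain ⟨η, h⟩ := (h0.and ((hc 2 ε hε).and (eventually_all.mpr fun i => hc 3 _ (hα i)))).exists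
    exact ⟨η, h⟩
  choose f hf1 hfφ using fun i =>
    exists_norm_le_one_lt_re_apply (φ i) (r := 1 - η) (by rw [hφ i]; linarith)
  -- Each functional contributes at most `3 + 3` to the total over `k`; if every `k` exceeded `η`,
  -- then `N * η ≤ 6 * n`.
  obtain ⟨N, hN⟩ := exists_nat_gt (n * 6 / η)
  obtain ⟨h', hA', hst, hsum, hnorm⟩ := hA N η hη
  set h : Fin N → A := fun k => ⟨h' k, hA' k⟩ with hh
  obtain ⟨k, hk⟩ : ∃ k, ∑ i, (‖φ i (f i * h k)‖ + ‖φ i (h k)‖) ≤ η := by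
    by_contra! hcon
    have hN0 : 0 < N := by
      rw [← Nat.cast_pos (α := ℝ)]
      exact lt_of_le_of_lt (by positivity) hN
    have : NeZero N := ⟨hN0.ne'⟩
    have h1 : ∑ k : Fin N, ∑ i, (‖φ i (f i * h k)‖ + ‖φ i (h k)‖) ≤ n * 6 := by
      rw [Finset.sum_comm]
      refine (Finset.sum_le_card_nsmul _ _ 6 fun i _ => ?_).trans_eq (by simp)
      rw [Finset.sum_add_distrib]
      have e1 := sum_norm_apply_mul_le (φ i) (hφ i) (f i) (hf1 i) h (C := 3) (by norm_num) hsum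
      have e2 := sum_norm_apply_le_of_forall_norm_sum_le (φ i) h 3 fun c hc => by
        change ‖((∑ k, c k • h k : A) : Ω →ᵇ ℂ)‖ ≤ 3
        refine (BoundedContinuousFunction.norm_le (by norm_num)).mpr fun x => ?_
        have hx : ((∑ k, c k • h k : A) : Ω →ᵇ ℂ) x = ∑ k, c k * h' k x := by
          rw [AddSubmonoidClass.coe_finsetSum, BoundedContinuousFunction.sum_apply]
          rfl
        rw [hx]
        refine (norm_sum_le _ _).trans (le_trans (Finset.sum_le_sum fun k _ => ?_) (hsum x))
        rw [norm_mul, hc, one_mul]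
      rw [hφ i] at e2
      linarith
    have h2 : (N : ℝ) * η ≤ ∑ k : Fin N, ∑ i, (‖φ i (f i * h k)‖ + ‖φ i (h k)‖) := by
      refine Eq.trans_le (by simp) (Finset.card_nsmul_le_sum _ _ η fun k _ => (hcon k).le)
    rw [div_lt_iff₀ hη] at hN
    linarith
  have hki : ∀ i, ‖φ i (f i * h k)‖ + ‖φ i (h k)‖ ≤ η := fun i =>
    (Finset.single_le_sum (f := fun i => ‖φ i (f i * h k)‖ + ‖φ i (h k)‖)
      (fun j _ => by positivity) (Finset.mem_univ i)).trans hk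
  set t : ℝ := (1 + η)⁻¹ with ht
  have ht0 : 0 < t := by positivity
  have ht1 : t * (1 + η) = 1 := inv_mul_cancel₀ (by positivity)
  -- The scalar `c` treats `x i`, `x i + y` and `x i - y` together, as `c = 0, 1, -1`.
  have hnorm_le : ∀ i (c : ℂ), ‖c‖ ≤ 1 →
      ‖(t : ℂ) • (f i * (1 - h k)) + c • ((t : ℂ) • h k)‖ ≤ 1 := by
    intro i c hc
    change ‖(((t : ℂ) • (f i * (1 - h k)) + c • ((t : ℂ) • h k) : A) : Ω →ᵇ ℂ)‖ ≤ 1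
    refine (BoundedContinuousFunction.norm_le zero_le_one).mpr fun x => ?_
    change ‖(t : ℂ) * ((f i : Ω →ᵇ ℂ) x * (1 - h' k x)) + c * ((t : ℂ) * h' k x)‖ ≤ 1
    have hfx : ‖(f i : Ω →ᵇ ℂ) x‖ ≤ 1 := ((f i : Ω →ᵇ ℂ).norm_coe_le_norm x).trans (hf1 i)
    refine (norm_add_le _ _).trans ?_
    simp only [norm_mul, Complex.norm_real, Real.norm_of_nonneg ht0.le]
    calc t * (‖(f i : Ω →ᵇ ℂ) x‖ * ‖1 - h' k x‖) + ‖c‖ * (t * ‖h' k x‖)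
        ≤ t * (1 * ‖1 - h' k x‖) + 1 * (t * ‖h' k x‖) := by gcongr
      _ = t * (‖h' k x‖ + ‖1 - h' k x‖) := by ring
      _ ≤ t * (1 + η) := mul_le_mul_of_nonneg_left (hst k x) ht0.le
      _ = 1 := ht1
  have hslice : ∀ i (c : ℂ), ‖c‖ ≤ 1 →
      (t : ℂ) • (f i * (1 - h k)) + c • ((t : ℂ) • h k) ∈ unitBallSlice (φ i) (α i) := by
    intro i c hc
    refine ⟨hnorm_le i c hc, ?_⟩
    have e : φ i ((t : ℂ) • (f i * (1 - h k)) + c • ((t : ℂ) • h k))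
        = (t : ℂ) * (φ i (f i) - φ i (f i * h k) + c * φ i (h k)) := by
      rw [mul_sub, mul_one, map_add, map_smul, map_smul, map_smul, map_sub]
      simp only [smul_eq_mul]
      ring
    rw [e, Complex.re_ofReal_mul, Complex.add_re, Complex.sub_re]
    have a1 : (φ i (f i * h k)).re ≤ ‖φ i (f i * h k)‖ := Complex.re_le_norm _
    have a2 : -‖φ i (h k)‖ ≤ (c * φ i (h k)).re := by
      have b1 : ‖c * φ i (h k)‖ ≤ ‖φ i (h k)‖ := by
        rw [norm_mul]; exact mul_le_of_le_one_left (norm_nonneg _) hc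
      have b2 := (abs_le.mp (Complex.abs_re_le_norm (c * φ i (h k)))).1
      linarith
    have a3 : t * (1 - 2 * η) < t * ((φ i (f i)).re - (φ i (f i * h k)).re
        + (c * φ i (h k)).re) := by
      have := hki i
      have := hfφ i
      gcongr
      linarith
    -- Holds because `(1 - 3η)(1 + η) ≤ 1 - 2η`.
    have a4 : 1 - 3 * η ≤ t * (1 - 2 * η) := by
      have : t * ((1 - 3 * η) * (1 + η)) ≤ t * (1 - 2 * η) := by
        gcongr; nlinarith
      nlinarith
    linarith [hηα i]
  refine ⟨fun i => (t : ℂ) • (f i * (1 - h k)), (t : ℂ) • h k, ?_, ?_, fun i => ⟨?_, ?_, ?_⟩⟩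
  · change ‖(((t : ℂ) • h k : A) : Ω →ᵇ ℂ)‖ ≤ 1
    refine (BoundedContinuousFunction.norm_le zero_le_one).mpr fun x => ?_
    change ‖(t : ℂ) * h' k x‖ ≤ 1
    rw [norm_mul, Complex.norm_real, Real.norm_of_nonneg ht0.le, ← ht1]
    exact mul_le_mul_of_nonneg_left (by linarith [hst k x, norm_nonneg (1 - h' k x)]) ht0.le
  · rw [norm_smul, Complex.norm_real, Real.norm_of_nonneg ht0.le]
    have h1 : t * (1 - η) < t * ‖h k‖ := by gcongr; exact hnorm k
    nlinarith
  · simpa using hslice i 0 (by simp)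
  · simpa using hslice i 1 (by simp)
  · simpa [sub_eq_add_neg] using hslice i (-1) (by simp)

end SymmetricStrongDiameterTwo

/-! ### Peak systems in the ball algebras -/

section UnitBallAlgebras

variable (X : Type*) [NormedAddCommGroup X] [NormedSpace ℂ X]

theorem ballAu_le_ballAb : ballAu X ≤ ballAb X := fun _ hf => hf.1

theorem ballAb_le_ballCb : ballAb X ≤ ballCb X := fun _ _ => Algebra.mem_top

variable {X}

/-- The composition of a function in the disc algebra with a contractive functional, as a
function on the unit ball. -/
theorem exists_mem_ballAu_comp (ψ : StrongDual ℂ X) (hψ : ‖ψ‖ ≤ 1) {g : ℂ → ℂ}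
    (hg : DifferentiableOn ℂ g (closedBall 0 1)) :
    ∃ f ∈ ballAu X, ∀ x : UnitBall X, f x = g (ψ x) := by
  have hmaps : ∀ x : X, ‖x‖ ≤ 1 → ψ x ∈ closedBall (0 : ℂ) 1 := fun x hx => by
    rw [mem_closedBall_zero_iff]
    exact (ψ.le_opNorm x).trans (mul_le_one₀ hψ (norm_nonneg _) hx)
  have hmaps' : ∀ x : UnitBall X, ψ x ∈ closedBall (0 : ℂ) 1 := fun x =>
    hmaps x (mem_closedBall_zero_iff.mp x.2)
  have hK : IsCompact (closedBall (0 : ℂ) 1) := isCompact_closedBall _ _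
  have huc : UniformContinuous fun x : UnitBall X => g (ψ x) := by
    have h1 := uniformContinuousOn_iff_restrict.mp
      (hK.uniformContinuousOn_of_continuous hg.continuousOn)
    have h2 : UniformContinuous fun x : UnitBall X =>
        (⟨ψ x, hmaps' x⟩ : closedBall (0 : ℂ) 1) :=
      (ψ.uniformContinuous.comp uniformContinuous_subtype_val).subtype_mk _
    exact h1.comp h2
  obtain ⟨C, hC⟩ := hK.exists_bound_of_continuousOn hg.continuousOn
  refine ⟨BoundedContinuousFunction.ofNormedAddCommGroup (fun x : UnitBall X => g (ψ x))
    huc.continuous C fun x => hC _ (hmaps' x), ⟨⟨fun x => g (ψ x), ?_, fun _ _ => rfl⟩, huc⟩,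
    fun _ => rfl⟩
  refine hg.comp ψ.differentiable.differentiableOn fun x hx => hmaps x ?_
  exact (mem_ball_zero_iff.mp hx).le

theorem ballAu_separatesPoints (s t : UnitBall X) (hst : s ≠ t) :
    ∃ f ∈ ballAu X, f s ≠ f t := by
  obtain ⟨ψ, hψ, hψst⟩ := exists_dual_vector ℂ ((s : X) - t)
    (norm_ne_zero_iff.mpr (sub_ne_zero.mpr (Subtype.coe_injective.ne hst)))
  obtain ⟨f, hf, hfψ⟩ := exists_mem_ballAu_comp ψ hψ.le (g := id) differentiableOn_id
  refine ⟨f, hf, fun h => ?_⟩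
  rw [hfψ, hfψ, id, id, ← sub_eq_zero, ← map_sub, hψst] at h
  simp only [Complex.coe_algebraMap, Complex.ofReal_eq_zero, norm_eq_zero, sub_eq_zero] at h
  exact hst (Subtype.ext h)

/-- The peaks sit at separated points of the unit circle, so at each `x` at most one function is not
small. -/
theorem hasPeakSystems_ballAu [Nontrivial X] : HasPeakSystems (ballAu X) := by
  intro N ε hε
  obtain ⟨ξ⟩ : Nonempty (Fin N ↪ sphere (0 : ℂ) 1) := by
    have : Infinite (sphere (0 : ℂ) 1) := by
      -- The circle is connected, being a sphere in real dimension 2, and has two points.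
      refine Set.infinite_coe_iff.mpr ((isPreconnected_sphere ?_ 0 1).infinite_of_nontrivial
        ⟨1, by simp, -1, by simp, by norm_num⟩)
      rw [Complex.rank_real_complex]
      exact Cardinal.one_lt_two
    exact ⟨(Fin.valEmbedding).trans (Infinite.natEmbedding _)⟩
  have hξ : ∀ k, ‖(ξ k : ℂ)‖ = 1 := fun k => mem_sphere_zero_iff_norm.mp (ξ k).2
  -- Separation `2 * r` ensures that `ψ x` is within `r` of at most one `ξ l`.
  obtain ⟨r, hr, hsep⟩ : ∃ r : ℝ, 0 < r ∧ ∀ k l, k ≠ l → 2 * r ≤ ‖(ξ k : ℂ) - ξ l‖ := by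
    have h0 : ∀ᶠ r : ℝ in 𝓝[>] 0, 0 < r := self_mem_nhdsWithin
    have h1 : ∀ᶠ r : ℝ in 𝓝[>] 0, ∀ k l, k ≠ l → 2 * r ≤ ‖(ξ k : ℂ) - ξ l‖ := by
      refine eventually_all.mpr fun k => eventually_all.mpr fun l => ?_
      by_cases hkl : k = l
      · exact Eventually.of_forall fun _ h => absurd hkl h
      have hpos : 0 < ‖(ξ k : ℂ) - ξ l‖ :=
        norm_pos_iff.mpr (sub_ne_zero.mpr (Subtype.coe_injective.ne (ξ.injective.ne hkl)))
      have : Tendsto (fun r : ℝ => 2 * r) (𝓝[>] 0) (𝓝 0) := by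
        have : Continuous fun r : ℝ => 2 * r := by fun_prop
        simpa using (this.tendsto 0).mono_left nhdsWithin_le_nhds
      exact (this.eventually_le_const hpos).mono fun _ h _ => h
    exact (h0.and h1).exists
  -- Makes the sum of moduli at most `(1 + δ) + N * δ ≤ 2`.
  set δ : ℝ := min ε (N + 1 : ℝ)⁻¹ with hδ
  have hδ0 : 0 < δ := lt_min hε (by positivity)
  have hδε : δ ≤ ε := min_le_left _ _
  have hδN : δ * (N + 1) ≤ 1 := by
    rw [← le_div_iff₀ (by positivity), one_div]; exact min_le_right _ _
  obtain ⟨g, hgd, hgst, hgsmall, hg1⟩ := exists_disc_peak_function hδ0 hr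
  obtain ⟨z, hz⟩ := exists_ne (0 : X)
  obtain ⟨ψ, hψ, hψz⟩ := exists_dual_vector ℂ z (norm_ne_zero_iff.mpr hz)
  have hψk : ∀ k, ‖((ξ k : ℂ)⁻¹ • ψ : StrongDual ℂ X)‖ ≤ 1 := fun k => by
    rw [norm_smul, norm_inv, hξ, hψ]; norm_num
  choose h hmem hval using fun k => exists_mem_ballAu_comp ((ξ k : ℂ)⁻¹ • ψ) (hψk k) hgd
  have hle : ∀ k (x : UnitBall X), ‖((ξ k : ℂ)⁻¹ • ψ : StrongDual ℂ X) x‖ ≤ 1 := fun k x =>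
    (ContinuousLinearMap.le_opNorm _ _).trans
      (mul_le_one₀ (hψk k) (norm_nonneg _) (mem_closedBall_zero_iff.mp x.2))
  have hst : ∀ k x, ‖h k x‖ + ‖1 - h k x‖ ≤ 1 + δ := fun k x => by
    rw [hval]; exact hgst _ (hle k x)
  have hone : ∀ k x, ‖h k x‖ ≤ 1 + δ := fun k x => by
    linarith [hst k x, norm_nonneg (1 - h k x)]
  have hsmall : ∀ k (x : UnitBall X), r ≤ ‖(ξ k : ℂ) - ψ x‖ → ‖h k x‖ ≤ δ := fun k x hrx => by
    rw [hval]
    refine hgsmall _ (hle k x) (hrx.trans_eq ?_)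
    have hne : (ξ k : ℂ) ≠ 0 := norm_ne_zero_iff.mp (by rw [hξ]; exact one_ne_zero)
    have : 1 - ((ξ k : ℂ)⁻¹ • ψ : StrongDual ℂ X) x = (ξ k : ℂ)⁻¹ * ((ξ k : ℂ) - ψ x) := by
      rw [mul_sub, inv_mul_cancel₀ hne]; rfl
    rw [this, norm_mul, norm_inv, hξ, inv_one, one_mul]
  refine ⟨h, hmem, fun k x => (hst k x).trans (by gcongr), fun x => ?_, fun k => ?_⟩
  · by_cases hx : ∃ l, ‖(ξ l : ℂ) - ψ x‖ < r
    · obtain ⟨l, hl⟩ := hx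
      have hoff : ∀ k ∈ Finset.univ.erase l, ‖h k x‖ ≤ δ := fun k hk => by
        refine hsmall k x ?_
        have h1 := hsep k l (Finset.ne_of_mem_erase hk)
        have h2 := norm_sub_le_norm_sub_add_norm_sub (ξ k : ℂ) (ψ x) (ξ l)
        rw [norm_sub_rev (ψ x)] at h2
        linarith
      rw [← Finset.add_sum_erase _ _ (Finset.mem_univ l)]
      have h1 := Finset.sum_le_card_nsmul _ _ δ hoff
      have h2 : ((Finset.univ.erase l).card : ℝ) ≤ N := by
        exact_mod_cast (Finset.card_erase_le).trans_eq (by simp)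
      have h3 : ((Finset.univ.erase l).card : ℝ) * δ ≤ N * δ := by gcongr
      rw [nsmul_eq_mul] at h1
      nlinarith [hone l x]
    · push Not at hx
      have h1 := Finset.sum_le_card_nsmul Finset.univ (fun k => ‖h k x‖) δ
        fun k _ => hsmall k x (hx k)
      simp only [Finset.card_univ, Fintype.card_fin, nsmul_eq_mul] at h1
      nlinarith
  · have hz0 : (‖z‖ : ℂ) ≠ 0 := by simpa using hz
    -- The rotated functional takes the value 1 at this unit vector, where `h k` equals `g 1`.
    set p : X := ((ξ k : ℂ) * (‖z‖ : ℂ)⁻¹) • z with hp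
    have hpn : ‖p‖ = 1 := by
      rw [hp, norm_smul, norm_mul, hξ, norm_inv, Complex.norm_real, norm_norm, one_mul,
        inv_mul_cancel₀ (norm_ne_zero_iff.mpr hz)]
    have hne : (ξ k : ℂ) ≠ 0 := norm_ne_zero_iff.mp (by rw [hξ]; exact one_ne_zero)
    have hp1 : ((ξ k : ℂ)⁻¹ • ψ : StrongDual ℂ X) p = 1 := by
      change (ξ k : ℂ)⁻¹ • ψ p = 1
      rw [hp, map_smul, hψz, smul_eq_mul, smul_eq_mul]
      simp only [Complex.coe_algebraMap]
      field_simp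
    have := (h k).norm_coe_le_norm ⟨p, mem_closedBall_zero_iff.mpr hpn.le⟩
    rw [hval, hp1] at this
    linarith

/-! ### Closedness under uniform limits -/

/-- A uniform limit of holomorphic functions on an open ball of a normed space is holomorphic. -/
theorem differentiableOn_ball_of_tendstoUniformlyOn {F : ℕ → X → ℂ} {G : X → ℂ} {c : X} {R : ℝ}
    (hF : ∀ n, DifferentiableOn ℂ (F n) (ball c R))
    (hFG : TendstoUniformlyOn F G atTop (ball c R)) : DifferentiableOn ℂ G (ball c R) := by
  intro x hx
  set ρ : ℝ := (R - dist x c) / 2 with hρ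
  have hρ0 : 0 < ρ := by have := mem_ball.mp hx; rw [hρ]; linarith
  have hsub : ∀ y ∈ ball x ρ, ball y ρ ⊆ ball c R := fun y hy w hw => by
    have h1 := mem_ball.mp hy
    have h2 := mem_ball.mp hw
    have h3 := dist_triangle4 w y x c
    rw [mem_ball]
    linarith
  have hs : ball x ρ ⊆ ball c R := hsub x (mem_ball_self hρ0)
  have hdat : ∀ n, ∀ y ∈ ball x ρ, DifferentiableAt ℂ (F n) y := fun n y hy =>
    (hF n).differentiableAt (isOpen_ball.mem_nhds (hs hy))
  -- Cauchy estimate on balls of radius `ρ`: `F m - F n` varies by at most `ε * ρ / 2` from its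
  -- value at the centre, so its derivative there has norm at most `ε / 2`.
  have hcauchy : UniformCauchySeqOn (fun n => fderiv ℂ (F n)) atTop (ball x ρ) := by
    rw [Metric.uniformCauchySeqOn_iff]
    intro ε hε
    obtain ⟨M, hM⟩ := Metric.uniformCauchySeqOn_iff.mp hFG.uniformCauchySeqOn
      (ε * ρ / 4) (by positivity)
    refine ⟨M, fun m hm n hn y hy => ?_⟩
    have hb : ∀ w ∈ ball y ρ, ‖F m w - F n w‖ ≤ ε * ρ / 4 := fun w hw => by
      rw [← dist_eq_norm]; exact (hM m hm n hn w (hsub y hy hw)).le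
    rw [dist_eq_norm, ← fderiv_sub (hdat m y hy) (hdat n y hy)]
    have := Complex.norm_fderiv_le_div_of_mapsTo_ball (f := F m - F n) (c := y) (R₁ := ρ)
      (R₂ := ε * ρ / 2) (((hF m).sub (hF n)).mono (hsub y hy)) (fun w hw => by
        rw [mem_closedBall, dist_eq_norm]
        refine (norm_sub_le _ _).trans ?_
        have h1 := hb w hw
        have h2 := hb y (mem_ball_self hρ0)
        simp only [Pi.sub_apply]
        linarith) hρ0
    refine this.trans_lt ?_
    rw [div_lt_iff₀ hρ0]
    nlinarith
  -- The value 0 off the ball only serves to make the limit derivative a total function.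
  have hlim : ∀ y : X, ∃ L : X →L[ℂ] ℂ, y ∈ ball x ρ →
      Tendsto (fun n => fderiv ℂ (F n) y) atTop (𝓝 L) := fun y => by
    by_cases hy : y ∈ ball x ρ
    · obtain ⟨L, hL⟩ := cauchySeq_tendsto_of_complete (hcauchy.cauchySeq hy)
      exact ⟨L, fun _ => hL⟩
    · exact ⟨0, fun h => absurd h hy⟩
  choose G' hG' using hlim
  exact (hasFDerivAt_of_tendstoUniformlyOn isOpen_ball
    (hcauchy.tendstoUniformlyOn_of_tendsto hG') (fun n y hy => (hdat n y hy).hasFDerivAt)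
    (fun y hy => hFG.tendsto_at (hs hy))
    (mem_ball_self hρ0)).differentiableAt.differentiableWithinAt

theorem isClosed_ballAb : IsClosed (ballAb X : Set (UnitBall X →ᵇ ℂ)) := by
  refine isClosed_of_closure_subset fun f hf => ?_
  obtain ⟨u, hu, hlim⟩ := mem_closure_iff_seq_limit.mp hf
  choose F hF hFu using hu
  have hunif := BoundedContinuousFunction.tendsto_iff_tendstoUniformly.mp hlim
  classical
  -- The extension by 0 is immaterial: only the open ball is used.
  let G : X → ℂ := fun x => if hx : x ∈ closedBall (0 : X) 1 then f ⟨x, hx⟩ else 0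
  have hG : ∀ x : UnitBall X, G x = f x := fun x => dif_pos x.2
  refine ⟨G, differentiableOn_ball_of_tendstoUniformlyOn hF ?_, fun x _ => hG x⟩
  rw [Metric.tendstoUniformlyOn_iff]
  intro ε hε
  filter_upwards [Metric.tendstoUniformly_iff.mp hunif ε hε] with n hn x hx
  have := hn ⟨x, ball_subset_closedBall hx⟩
  rwa [← hG, ← hFu n ⟨x, ball_subset_closedBall hx⟩ hx] at this

theorem isClosed_setOf_uniformContinuous_boundedContinuousFunction {Ω : Type*} [UniformSpace Ω] :
    IsClosed {f : Ω →ᵇ ℂ | UniformContinuous f} := by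
  refine isClosed_of_closure_subset fun f hf => ?_
  obtain ⟨u, hu, hlim⟩ := mem_closure_iff_seq_limit.mp hf
  exact (BoundedContinuousFunction.tendsto_iff_tendstoUniformly.mp hlim).uniformContinuous
    (Frequently.of_forall hu)

theorem isFunctionAlgebra_of_ballAu_le {A : Subalgebra ℂ (UnitBall X →ᵇ ℂ)}
    (hA : IsClosed (A : Set (UnitBall X →ᵇ ℂ))) (hle : ballAu X ≤ A) : IsFunctionAlgebra A where
  isClosed := hA
  separatesPoints s t hst :=
    let ⟨f, hf, hfst⟩ := ballAu_separatesPoints s t hst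
    ⟨f, hle hf, hfst⟩

end UnitBallAlgebras

theorem mainTheorem12 (X : Type*) [NormedAddCommGroup X] [NormedSpace ℂ X] [CompleteSpace X]
    [Nontrivial X] :
    (IsFunctionAlgebra (ballCb X) ∧ HasSSD2P (ballCb X)) ∧
    (IsFunctionAlgebra (ballAb X) ∧ HasSSD2P (ballAb X)) ∧
    (IsFunctionAlgebra (ballAu X) ∧ HasSSD2P (ballAu X)) := by
  have hbc : ballAu X ≤ ballCb X := (ballAu_le_ballAb X).trans (ballAb_le_ballCb X)
  refine ⟨⟨isFunctionAlgebra_of_ballAu_le ?_ hbc, (hasPeakSystems_ballAu.mono hbc).hasSSD2P⟩,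
    ⟨isFunctionAlgebra_of_ballAu_le isClosed_ballAb (ballAu_le_ballAb X),
      (hasPeakSystems_ballAu.mono (ballAu_le_ballAb X)).hasSSD2P⟩,
    ⟨isFunctionAlgebra_of_ballAu_le ?_ le_rfl, hasPeakSystems_ballAu.hasSSD2P⟩⟩
  · simp [ballCb]
  · exact isClosed_ballAb.inter isClosed_setOf_uniformContinuous_boundedContinuousFunction
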